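/- For a positive integer $n$ let $r_3(n)$ denote the number of triples $(x,y,z)\in\mathbb{Z}^3$ with $x^2+y^2+z^2=n$. Let $m\ge 1$ be an integer. Then there is a constant $c>0$, depending only on $m$, such that for every integer $a$ that is a sum of three squares modulo $m$ (that is, $x^2+y^2+z^2\equiv a \pmod m$ for some integers $x,y,z$) there exist infinitely many positive integers $n\equiv a\pmod m$ with $$r_3(n)\;\ge\; c\,\sqrt{n}\,\log\log n .$$ -/

import Mathlib

/-- The set of representations of `n` as an ordered sum of three integer squares. -/
def threeSquareReps (n : ℕ) : Set (ℤ × ℤ × ℤ) :=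
  {v | v.1 ^ 2 + v.2.1 ^ 2 + v.2.2 ^ 2 = (n : ℤ)}

/-- There are finitely many representations, so that counting them by `Set.ncard` is meaningful. -/
theorem threeSquareReps_finite (n : ℕ) : (threeSquareReps n).Finite := by
  have hI : (Set.Icc (-(n : ℤ)) n).Finite := Set.finite_Icc _ _
  refine (hI.prod (hI.prod hI)).subset ?_
  rintro ⟨x, y, z⟩ h
  simp only [threeSquareReps, Set.mem_ofPred_eq] at h
  simp only [Set.mem_prod, Set.mem_Icc]
  refine ⟨⟨?_, ?_⟩, ⟨?_, ?_⟩, ⟨?_, ?_⟩⟩ <;>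
    nlinarith [sq_nonneg x, sq_nonneg y, sq_nonneg z,
      Int.le_self_sq x, Int.le_self_sq y, Int.le_self_sq z,
      Int.le_self_sq (-x), Int.le_self_sq (-y), Int.le_self_sq (-z)]

/-- `r₃(n)`, the number of triples `(x, y, z) ∈ ℤ³` with `x² + y² + z² = n`. -/
noncomputable def r3 (n : ℕ) : ℕ :=
  (threeSquareReps n).ncard

/-- The integer `a` is a sum of three squares modulo `m`. -/
def IsSumThreeSquaresMod (m : ℕ) (a : ℤ) : Prop :=
  ∃ x y z : ℤ, x ^ 2 + y ^ 2 + z ^ 2 ≡ a [ZMOD (m : ℤ)]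

/-! Let `q` be the product of the primes below `Y` not dividing `2m`, and `M = mq`. Prescribe a
residue `b` modulo `M` with `b ≡ a` mod `m` and `b ≡ -1` mod `q`. For each `p ∣ q` the quadric `x² +
y² + z² = -1` has at least `p² + p` points over `𝔽_p`, so by CRT `b` is represented at least `q² ∏
(1 + 1/p)` times modulo `M`. The representatives in `[0, M)³` have sums of squares below `3M²`,
hence at most `3M` values in the class of `b`; by pigeonhole some `n ≤ 3M²` has `r₃(n) ≥ (q / 3m) ∏
(1 + 1/p)`. The product is `≫ log Y`, `√n ≪ q`, and `q ≤ 4^Y` gives `log log n ≤ 2 log Y`, whence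
the bound. Also `r₃(n) ≫ log Y` is unbounded, which forces infinitely many `n`. -/

/-- The number of solutions of `x² + y² + z² = b` in a commutative ring. -/
noncomputable def threeSquareCount (R : Type*) [CommRing R] (b : R) : ℕ :=
  Nat.card {v : R × R × R // v.1 ^ 2 + v.2.1 ^ 2 + v.2.2 ^ 2 = b}

/-! ### Local solution counts -/

theorem threeSquareCount_ringEquiv {R S : Type*} [CommRing R] [CommRing S] (e : R ≃+* S) (b : R) :
    threeSquareCount R b = threeSquareCount S (e b) := by
  refine Nat.card_congr ((e.toEquiv.prodCongr (e.toEquiv.prodCongr e.toEquiv)).subtypeEquiv ?_)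
  rintro ⟨x, y, z⟩
  simp [← map_pow, ← map_add]

theorem threeSquareCount_prod {R S : Type*} [CommRing R] [CommRing S] (a : R) (b : S) :
    threeSquareCount (R × S) (a, b) = threeSquareCount R a * threeSquareCount S b := by
  unfold threeSquareCount
  rw [← Nat.card_prod]
  refine Nat.card_congr ⟨fun v => (⟨(v.1.1.1, v.1.2.1.1, v.1.2.2.1), ?_⟩,
    ⟨(v.1.1.2, v.1.2.1.2, v.1.2.2.2), ?_⟩), fun w => ⟨((w.1.1.1, w.2.1.1),
      (w.1.1.2.1, w.2.1.2.1), (w.1.1.2.2, w.2.1.2.2)), ?_⟩, fun v => rfl, fun w => rfl⟩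
  · simpa using congrArg Prod.fst v.2
  · simpa using congrArg Prod.snd v.2
  · exact Prod.ext (by simpa using w.1.2) (by simpa using w.2.2)

theorem threeSquareCount_neg_one_ge (p : ℕ) [Fact p.Prime] (hp : p ≠ 2) :
    p ^ 2 + p ≤ threeSquareCount (ZMod p) (-1) := by
  obtain ⟨a, b, hab⟩ := ZMod.sq_add_sq p (-1)
  have h2 : (2 : ZMod p) ≠ 0 := by
    have := ZMod.ringChar_zmod_n p
    exact Ring.two_ne_zero (by rwa [this])
  have h11 : (1 : ZMod p) ≠ -1 := by
    intro h
    exact h2 (by linear_combination h)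
  -- Points of `uv = w² - 1`: `u ≠ 0` and `w` determine `v`, giving `(p - 1)p`; `u = 0` forces `w =
  -- ±1` with `v` free, giving `2p`.
  let g : ((ZMod p)ˣ × ZMod p) ⊕ (Bool × ZMod p) → ZMod p × ZMod p × ZMod p := fun s =>
    s.elim (fun t => ((t.1 : ZMod p), (t.2 ^ 2 - 1) * ((t.1⁻¹ : (ZMod p)ˣ) : ZMod p), t.2))
      (fun t => (0, t.2, if t.1 then 1 else -1))
  have hg : ∀ s, (g s).1 * (g s).2.1 = (g s).2.2 ^ 2 - 1 := by
    rintro (⟨u, w⟩ | ⟨e, v⟩)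
    · simp only [g, Sum.elim_inl]
      linear_combination (w ^ 2 - 1) * u.mul_inv
    · simp only [g, Sum.elim_inr]
      cases e <;> simp
  have hgi : Function.Injective g := by
    rintro (⟨u, w⟩ | ⟨e, v⟩) (⟨u', w'⟩ | ⟨e', v'⟩) h
    · simp only [g, Sum.elim_inl, Prod.mk.injEq] at h
      obtain ⟨h1, -, h3⟩ := h
      rw [Units.ext h1, h3]
    · simp only [g, Sum.elim_inl, Sum.elim_inr, Prod.mk.injEq] at h
      exact absurd h.1 u.ne_zero
    · simp only [g, Sum.elim_inl, Sum.elim_inr, Prod.mk.injEq] at h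
      exact absurd h.1.symm u'.ne_zero
    · simp only [g, Sum.elim_inr, Prod.mk.injEq, true_and] at h
      obtain ⟨h1, h3⟩ := h
      cases e <;> cases e' <;> simp_all
  -- As `a² + b² = -1`, this linear change of variables turns `x² + y² + z²` into `uv - w²`.
  let k : ZMod p × ZMod p × ZMod p → ZMod p × ZMod p × ZMod p := fun t =>
    (-(a * ((t.2.1 - t.1) / 2) + b * t.2.2), -(b * ((t.2.1 - t.1) / 2) - a * t.2.2),
      (t.1 + t.2.1) / 2)
  have hki : Function.Injective k := by
    rintro ⟨u, v, w⟩ ⟨u', v', w'⟩ h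
    simp only [k, Prod.mk.injEq] at h
    obtain ⟨h1, h2', h3⟩ := h
    have hs : u + v = u' + v' := by field_simp at h3; exact h3
    have hw : w = w' := by
      linear_combination b * h1 - a * h2' + (w - w') * hab
    have hd : (v - u) / 2 = (v' - u') / 2 := by
      linear_combination a * h1 + b * h2' + ((v - u) / 2 - (v' - u') / 2) * hab
    have hd' : v - u = v' - u' := by field_simp at hd; exact hd
    have hu : u = u' := mul_left_cancel₀ h2 (by linear_combination hs - hd')
    have hv : v = v' := by linear_combination hs - hu
    rw [hu, hv, hw]
  have hk : ∀ s, (k (g s)).1 ^ 2 + (k (g s)).2.1 ^ 2 + (k (g s)).2.2 ^ 2 = -1 := by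
    intro s
    have h := hg s
    set t := g s
    have h4 : ((t.1 + t.2.1) / 2) ^ 2 - ((t.2.1 - t.1) / 2) ^ 2 = t.1 * t.2.1 := by
      field_simp; ring
    simp only [k]
    linear_combination (((t.2.1 - t.1) / 2) ^ 2 + t.2.2 ^ 2) * hab + h4 + h
  let F : ((ZMod p)ˣ × ZMod p) ⊕ (Bool × ZMod p) →
      {v : ZMod p × ZMod p × ZMod p // v.1 ^ 2 + v.2.1 ^ 2 + v.2.2 ^ 2 = -1} :=
    fun s => ⟨k (g s), hk s⟩
  have hF : Function.Injective F := fun s t h => hgi (hki (congrArg Subtype.val h))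
  have hcard := Nat.card_le_card_of_injective F hF
  have hp1 := (Fact.out : p.Prime).one_le
  rw [Nat.card_sum, Nat.card_prod, Nat.card_prod, Nat.card_zmod, Nat.card_eq_fintype_card (α := (ZMod p)ˣ),
    ZMod.card_units, Nat.card_eq_fintype_card (α := Bool), Fintype.card_bool] at hcard
  refine le_trans (le_of_eq ?_) hcard
  zify [hp1]
  ring

theorem threeSquareCount_neg_one_prod_ge (s : Finset ℕ) (hs : ∀ p ∈ s, p.Prime ∧ p ≠ 2) :
    ∏ p ∈ s, (p ^ 2 + p) ≤ threeSquareCount (ZMod (∏ p ∈ s, p)) (-1) := by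
  induction s using Finset.induction_on with
  | empty =>
    rw [Finset.prod_empty, Finset.prod_empty]
    have : Nonempty {v : ZMod 1 × ZMod 1 × ZMod 1 // v.1 ^ 2 + v.2.1 ^ 2 + v.2.2 ^ 2 = -1} :=
      ⟨⟨0, Subsingleton.elim (α := ZMod 1) _ _⟩⟩
    exact Nat.card_pos
  | insert p s hps ih =>
    have hp := hs p (Finset.mem_insert_self p s)
    have hs' : ∀ l ∈ s, l.Prime ∧ l ≠ 2 := fun l hl => hs l (Finset.mem_insert_of_mem hl)
    have hco : Nat.Coprime p (∏ l ∈ s, l) := Nat.Coprime.prod_right fun l hl =>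
      (Nat.coprime_primes hp.1 (hs' l hl).1).2 fun h => hps (h ▸ hl)
    have : Fact p.Prime := ⟨hp.1⟩
    rw [Finset.prod_insert hps, Finset.prod_insert hps,
      threeSquareCount_ringEquiv (ZMod.chineseRemainder hco) (-1), map_neg, map_one,
      show (-1 : ZMod p × ZMod (∏ l ∈ s, l)) = (-1, -1) from rfl, threeSquareCount_prod]
    exact Nat.mul_le_mul (threeSquareCount_neg_one_ge p hp.2) (ih hs')

/-! ### From residues to integers by pigeonhole -/

theorem exists_threeSquareCount_le_r3 (M : ℕ) [NeZero M] (b : ZMod M) :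
    ∃ n : ℕ, (n : ZMod M) = b ∧ n ≤ 3 * M ^ 2 ∧ threeSquareCount (ZMod M) b ≤ 3 * M * r3 n := by
  classical
  have hM : 0 < M := NeZero.pos M
  let S : Finset (ZMod M × ZMod M × ZMod M) :=
    Finset.univ.filter fun v => v.1 ^ 2 + v.2.1 ^ 2 + v.2.2 ^ 2 = b
  have hS : threeSquareCount (ZMod M) b = S.card := by
    rw [threeSquareCount, Nat.card_eq_fintype_card, Fintype.card_subtype]
  let f : ZMod M × ZMod M × ZMod M → ℕ := fun v => v.1.val ^ 2 + v.2.1.val ^ 2 + v.2.2.val ^ 2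
  have hf : ∀ v, f v < 3 * M ^ 2 := fun v => by
    have h1 := Nat.pow_lt_pow_left (ZMod.val_lt v.1) two_ne_zero
    have h2 := Nat.pow_lt_pow_left (ZMod.val_lt v.2.1) two_ne_zero
    have h3 := Nat.pow_lt_pow_left (ZMod.val_lt v.2.2) two_ne_zero
    simp only [f]
    omega
  -- Within the class of `b`, the quotient by `M` determines the value of `f`.
  have hmaps : ∀ v ∈ S, f v / M ∈ Finset.range (3 * M) := fun v _ => by
    rw [Finset.mem_range, Nat.div_lt_iff_lt_mul hM]
    exact (hf v).trans_eq (by ring)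
  obtain ⟨k, hk, hle⟩ := Finset.exists_le_card_fiber_of_nsmul_le_card_of_maps_to
    (b := (S.card : ℚ) / (3 * M)) hmaps ⟨0, Finset.mem_range.2 (by omega)⟩ (by
      rw [Finset.card_range, nsmul_eq_mul]
      push_cast
      field_simp
      rfl)
  have hkM := Finset.mem_range.1 hk
  refine ⟨b.val + M * k, by simp, ?_, ?_⟩
  · have := b.val_lt
    nlinarith
  · have hfib : (S.filter fun v => f v / M = k).card ≤ r3 (b.val + M * k) := by
      rw [r3, ← Set.ncard_coe_finset]
      refine Set.ncard_le_ncard_of_injOn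
        (fun v => ((v.1.val : ℤ), (v.2.1.val : ℤ), (v.2.2.val : ℤ))) ?_ ?_ (threeSquareReps_finite _)
      · intro v hv
        obtain ⟨hvS, hvk⟩ := Finset.mem_filter.1 (Finset.mem_coe.1 hv)
        have hvb := (Finset.mem_filter.1 hvS).2
        have hfb : ((f v : ℕ) : ZMod M) = b := by simpa [f] using hvb
        have hmod : f v % M = b.val := by rw [← hfb, ZMod.val_natCast]
        have hfv : f v = b.val + M * k := by rw [← hmod, ← hvk, Nat.mod_add_div]
        change (v.1.val : ℤ) ^ 2 + (v.2.1.val : ℤ) ^ 2 + (v.2.2.val : ℤ) ^ 2 = _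
        rw [← hfv]
        simp [f]
      · rintro ⟨x, y, z⟩ - ⟨x', y', z'⟩ - h
        simp only [Prod.mk.injEq, Nat.cast_inj] at h
        rw [ZMod.val_injective M h.1, ZMod.val_injective M h.2.1, ZMod.val_injective M h.2.2]
    have h3 : (S.card : ℚ) / (3 * M) ≤ r3 (b.val + M * k) := hle.trans (by exact_mod_cast hfib)
    rw [div_le_iff₀ (by positivity)] at h3
    rw [hS]
    have : S.card ≤ r3 (b.val + M * k) * (3 * M) := by exact_mod_cast h3
    linarith

/-! ### Mertens-type lower bounds -/

theorem log_le_prod_primesBelow (Y : ℕ) (hY : 1 ≤ Y) :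
    Real.log Y ≤ ∏ p ∈ Y.primesBelow, (1 - (p : ℝ)⁻¹)⁻¹ := by
  let f : ℕ →* ℝ := ⟨⟨fun n => (n : ℝ)⁻¹, by simp⟩, fun a b => by simp [mul_comm]⟩
  have hfn : ∀ {p : ℕ}, p.Prime → ‖f p‖ < 1 := fun {p} hp => by
    have : (1 : ℝ) < p := by exact_mod_cast hp.one_lt
    simpa [f] using inv_lt_one_of_one_lt₀ this
  have H := (EulerProduct.summable_and_hasSum_smoothNumbers_prod_primesBelow_geometric hfn Y).2
  have hinj : ∀ n : ℕ, n ∈ Finset.Icc 1 (Y - 1) → n ∈ Y.smoothNumbers := fun n hn => by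
    have := Finset.mem_Icc.1 hn
    exact Nat.mem_smoothNumbers_of_lt (by omega) (by omega)
  have h1 : ∑ n ∈ Finset.Icc 1 (Y - 1), (n : ℝ)⁻¹ ≤ ∏ p ∈ Y.primesBelow, (1 - (p : ℝ)⁻¹)⁻¹ := by
    have := sum_le_hasSum ((Finset.Icc 1 (Y - 1)).subtype (· ∈ Y.smoothNumbers))
      (fun i _ => by simp [f]) H
    rwa [Finset.sum_subtype_of_mem (fun n => f n) hinj] at this
  have h2 := log_add_one_le_harmonic (Y - 1)
  rw [Nat.sub_add_cancel hY, harmonic_eq_sum_Icc] at h2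
  push_cast at h2
  exact h2.trans h1

theorem prod_Ico_one_sub_inv_sq (Y : ℕ) (hY : 2 ≤ Y) :
    ∏ k ∈ Finset.Ico 2 Y, (1 - ((k : ℝ)⁻¹) ^ 2) = (Y : ℝ) / (2 * ((Y : ℝ) - 1)) := by
  induction Y, hY using Nat.le_induction with
  | base => norm_num
  | succ n hn ih =>
    have : (2 : ℝ) ≤ n := by exact_mod_cast hn
    have : (n : ℝ) - 1 ≠ 0 := by linarith
    rw [Finset.prod_Ico_succ_top hn, ih]
    push_cast
    rw [add_sub_cancel_right]
    field_simp
    ring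

/-- Since `1 + 1/p = (1 - 1/p²) / (1 - 1/p)`, the Euler product bound loses only `∏ (1 - 1/p²)`,
which is at least the telescoping product over all `k ≥ 2`, hence at least `1/2`. -/
theorem half_log_le_prod_primesBelow (Y : ℕ) (hY : 2 ≤ Y) :
    Real.log Y / 2 ≤ ∏ p ∈ Y.primesBelow, (1 + (p : ℝ)⁻¹) := by
  have hlt : ∀ k : ℕ, 2 ≤ k → (k : ℝ)⁻¹ < 1 := fun k hk => by
    have : (1 : ℝ) < k := by exact_mod_cast hk
    exact inv_lt_one_of_one_lt₀ this
  have hmem : ∀ p ∈ Y.primesBelow, 2 ≤ p := fun p hp => (Nat.prime_of_mem_primesBelow hp).two_le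
  have hsub : Y.primesBelow ⊆ Finset.Ico 2 Y := fun p hp =>
    Finset.mem_Ico.2 ⟨hmem p hp, Nat.lt_of_mem_primesBelow hp⟩
  have hhalf : (1 / 2 : ℝ) ≤ ∏ p ∈ Y.primesBelow, (1 - ((p : ℝ)⁻¹) ^ 2) := by
    have h1 : (1 / 2 : ℝ) ≤ ∏ k ∈ Finset.Ico 2 Y, (1 - ((k : ℝ)⁻¹) ^ 2) := by
      rw [prod_Ico_one_sub_inv_sq Y hY]
      have : (2 : ℝ) ≤ Y := by exact_mod_cast hY
      rw [div_le_div_iff₀ (by norm_num) (by linarith)]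
      linarith
    have h0 : ∀ k ∈ Finset.Ico 2 Y, 0 ≤ 1 - ((k : ℝ)⁻¹) ^ 2 := fun k hk => by
      have := hlt k (Finset.mem_Ico.1 hk).1
      have : (0 : ℝ) ≤ (k : ℝ)⁻¹ := by positivity
      nlinarith
    rw [← Finset.prod_sdiff hsub] at h1
    refine h1.trans (mul_le_of_le_one_left (Finset.prod_nonneg fun k hk => h0 k (hsub hk)) ?_)
    refine Finset.prod_le_one (fun k hk => h0 k (Finset.sdiff_subset hk)) fun k _ => ?_
    have := sq_nonneg ((k : ℝ)⁻¹)
    linarith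
  have hpos : 0 ≤ ∏ p ∈ Y.primesBelow, (1 - (p : ℝ)⁻¹)⁻¹ :=
    Finset.prod_nonneg fun p hp => by
      have := hlt p (hmem p hp)
      exact inv_nonneg.2 (by linarith)
  calc Real.log Y / 2 = Real.log Y * (1 / 2) := by ring
    _ ≤ (∏ p ∈ Y.primesBelow, (1 - (p : ℝ)⁻¹)⁻¹) * ∏ p ∈ Y.primesBelow, (1 - ((p : ℝ)⁻¹) ^ 2) :=
        mul_le_mul (log_le_prod_primesBelow Y (by omega)) hhalf (by norm_num) hpos
    _ = ∏ p ∈ Y.primesBelow, (1 + (p : ℝ)⁻¹) := by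
        rw [← Finset.prod_mul_distrib]
        refine Finset.prod_congr rfl fun p hp => ?_
        have h : 1 - (p : ℝ)⁻¹ ≠ 0 := by linarith [hlt p (hmem p hp)]
        rw [show 1 - ((p : ℝ)⁻¹) ^ 2 = (1 - (p : ℝ)⁻¹) * (1 + (p : ℝ)⁻¹) by ring,
          inv_mul_cancel_left₀ h]

/-- The primes below `Y` that do not divide `d`. -/
def primesBelowNotDvd (d Y : ℕ) : Finset ℕ :=
  Y.primesBelow.filter fun p => ¬ p ∣ d

theorem half_log_le_mul_prod_primesBelowNotDvd (d Y : ℕ) (hd : d ≠ 0) (hY : 2 ≤ Y) :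
    Real.log Y / 2 ≤
      2 ^ d.primeFactors.card * ∏ p ∈ primesBelowNotDvd d Y, (1 + (p : ℝ)⁻¹) := by
  refine (half_log_le_prod_primesBelow Y hY).trans ?_
  rw [← Finset.prod_filter_mul_prod_filter_not Y.primesBelow (fun p => p ∣ d)]
  refine mul_le_mul_of_nonneg_right ?_ (Finset.prod_nonneg fun p _ => by positivity)
  have hsub : Y.primesBelow.filter (fun p => p ∣ d) ⊆ d.primeFactors := fun p hp => by
    obtain ⟨h1, h2⟩ := Finset.mem_filter.1 hp
    exact Nat.mem_primeFactors.2 ⟨Nat.prime_of_mem_primesBelow h1, h2, hd⟩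
  calc ∏ p ∈ Y.primesBelow.filter (fun p => p ∣ d), (1 + (p : ℝ)⁻¹)
      ≤ ∏ p ∈ Y.primesBelow.filter (fun p => p ∣ d), (2 : ℝ) := by
        refine Finset.prod_le_prod (fun p _ => by positivity) fun p _ => ?_
        have := Nat.cast_inv_le_one (α := ℝ) p
        linarith
    _ = 2 ^ (Y.primesBelow.filter (fun p => p ∣ d)).card := Finset.prod_const _
    _ ≤ 2 ^ d.primeFactors.card := pow_le_pow_right₀ one_le_two (Finset.card_le_card hsub)

theorem prod_primesBelowNotDvd_le (d Y : ℕ) : ∏ p ∈ primesBelowNotDvd d Y, p ≤ 4 ^ Y := by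
  refine le_trans ?_ (primorial_le_four_pow Y)
  refine Finset.prod_le_prod_of_subset_of_one_le' (fun p hp => ?_) fun p hp _ =>
    (Finset.mem_filter.1 hp).2.one_le
  have h := (Finset.mem_filter.1 hp).1
  exact Finset.mem_filter.2 ⟨Finset.mem_range.2 ((Nat.lt_of_mem_primesBelow h).trans Y.lt_succ_self),
    Nat.prime_of_mem_primesBelow h⟩

/-! ### Size of the iterated logarithm -/

theorem log_log_le_of_le {n N : ℕ} (hnN : n ≤ N) (hN : 3 ≤ N) :
    Real.log (Real.log n) ≤ Real.log (Real.log N) := by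
  have hN' : 1 ≤ Real.log N := by
    rw [Real.le_log_iff_exp_le (by positivity)]
    exact Real.exp_one_lt_three.le.trans (by exact_mod_cast hN)
  -- If `log n = 0`, the left side is the default value `log 0 = 0`; `N ≥ 3` makes the right side
  -- nonnegative.
  rcases (Real.log_natCast_nonneg n).eq_or_lt with h | h
  · rw [← h, Real.log_zero]
    exact Real.log_nonneg hN'
  · refine Real.log_le_log h (Real.log_le_log ?_ (by exact_mod_cast hnN))
    rcases Nat.eq_zero_or_pos n with rfl | hn
    · simp at h
    · exact_mod_cast hn

theorem log_log_le_two_mul_log {m M Y : ℕ} (hM1 : 1 ≤ M) (hM : M ≤ m * 4 ^ Y)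
    (hY : 3 * m ^ 2 + 4 ≤ Y) :
    Real.log (Real.log ((3 * M ^ 2 : ℕ) : ℝ)) ≤ 2 * Real.log Y := by
  have hm : 1 ≤ m := Nat.one_le_iff_ne_zero.2 (by rintro rfl; omega)
  have hYr : (3 * m ^ 2 + 4 : ℝ) ≤ Y := by exact_mod_cast hY
  have hm' : (0 : ℝ) < m := by exact_mod_cast hm
  have hle : ((3 * M ^ 2 : ℕ) : ℝ) ≤ (3 * m ^ 2) * 16 ^ Y := by
    have : 3 * M ^ 2 ≤ 3 * m ^ 2 * 16 ^ Y := by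
      calc 3 * M ^ 2 ≤ 3 * (m * 4 ^ Y) ^ 2 := by gcongr
        _ = 3 * m ^ 2 * 16 ^ Y := by
          rw [mul_pow, ← pow_mul, mul_comm Y 2, pow_mul]; norm_num; ring
    exact_mod_cast this
  have hMpos : (0 : ℝ) < ((3 * M ^ 2 : ℕ) : ℝ) := by exact_mod_cast (by positivity)
  have h16 : Real.log 16 ≤ 3 := by
    rw [show (16 : ℝ) = 2 ^ 4 by norm_num, Real.log_pow]
    have := Real.log_two_lt_d9
    push_cast
    linarith
  have hlog : Real.log ((3 * M ^ 2 : ℕ) : ℝ) ≤ (Y : ℝ) ^ 2 := by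
    calc Real.log ((3 * M ^ 2 : ℕ) : ℝ) ≤ Real.log ((3 * m ^ 2) * 16 ^ Y) :=
          Real.log_le_log hMpos hle
      _ = Real.log (3 * m ^ 2) + Y * Real.log 16 := by
          rw [Real.log_mul (by positivity) (by positivity), Real.log_pow]
      _ ≤ (3 * m ^ 2) + Y * 3 := by
          have := Real.log_le_self (x := 3 * (m : ℝ) ^ 2) (by positivity)
          gcongr
      -- `3m² ≤ Y - 4` bounds the left side by `4Y - 4 ≤ Y²`.
      _ ≤ (Y : ℝ) ^ 2 := by nlinarith
  have hlpos : 0 < Real.log ((3 * M ^ 2 : ℕ) : ℝ) := by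
    refine Real.log_pos ?_
    have : 1 < 3 * M ^ 2 := by nlinarith
    exact_mod_cast this
  calc Real.log (Real.log ((3 * M ^ 2 : ℕ) : ℝ)) ≤ Real.log ((Y : ℝ) ^ 2) := Real.log_le_log hlpos hlog
    _ = 2 * Real.log Y := by rw [Real.log_pow]; norm_num

/-! ### Assembly -/

/-- In every class `a` mod `m` that is a sum of three squares, and for every large `Y`, some `n` has
both `r₃(n) ≫ √n log log n` and `r₃(n) ≫ log Y`. -/
theorem exists_r3_ge (m : ℕ) (hm : 1 ≤ m) (a : ℤ) (ha : IsSumThreeSquaresMod m a) (Y : ℕ)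
    (hY : 3 * m ^ 2 + 4 ≤ Y) :
    ∃ n : ℕ, (n : ℤ) ≡ a [ZMOD (m : ℤ)] ∧
      1 / (24 * m ^ 2 * 2 ^ (2 * m).primeFactors.card) *
        (Real.sqrt (n : ℝ) * Real.log (Real.log (n : ℝ))) ≤ (r3 n : ℝ) ∧
      1 / (6 * m ^ 2 * 2 ^ (2 * m).primeFactors.card) * Real.log Y ≤ (r3 n : ℝ) := by
  set D : ℝ := 2 ^ (2 * m).primeFactors.card with hD
  have hDpos : 0 < D := by positivity
  set s := primesBelowNotDvd (2 * m) Y with hs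
  have hprime : ∀ p ∈ s, p.Prime := fun p hp =>
    Nat.prime_of_mem_primesBelow (Finset.mem_filter.1 hp).1
  have hndvd : ∀ p ∈ s, ¬ p ∣ 2 * m := fun p hp => (Finset.mem_filter.1 hp).2
  set q := ∏ p ∈ s, p with hq
  have hqpos : 0 < q := Finset.prod_pos fun p hp => (hprime p hp).pos
  have hco : Nat.Coprime m q := Nat.Coprime.prod_right fun p hp =>
    ((hprime p hp).coprime_iff_not_dvd.2 fun h => hndvd p hp (h.mul_left 2)).symm
  have : NeZero m := ⟨by omega⟩
  have : NeZero (m * q) := ⟨by positivity⟩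
  let e := ZMod.chineseRemainder hco
  obtain ⟨n, hnb, hnle, hcount⟩ := exists_threeSquareCount_le_r3 (m * q) (e.symm ((a : ZMod m), -1))
  rw [threeSquareCount_ringEquiv e, RingEquiv.apply_symm_apply, threeSquareCount_prod] at hcount
  have hna : (n : ZMod m) = a := by
    have h := congrArg e hnb
    rw [RingEquiv.apply_symm_apply, map_natCast] at h
    simpa using congrArg Prod.fst h
  have hone : 1 ≤ threeSquareCount (ZMod m) a := by
    obtain ⟨x, y, z, hxyz⟩ := ha
    have h := (ZMod.intCast_eq_intCast_iff _ _ _).2 hxyz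
    push_cast at h
    have : Nonempty {v : ZMod m × ZMod m × ZMod m //
      v.1 ^ 2 + v.2.1 ^ 2 + v.2.2 ^ 2 = (a : ZMod m)} := ⟨⟨(x, y, z), h⟩⟩
    exact Nat.card_pos
  have hprod := threeSquareCount_neg_one_prod_ge s fun p hp =>
    ⟨hprime p hp, fun h => hndvd p hp (h ▸ Dvd.intro m rfl)⟩
  set P : ℝ := ∏ p ∈ s, (1 + (p : ℝ)⁻¹) with hP
  have hPq : ((∏ p ∈ s, (p ^ 2 + p) : ℕ) : ℝ) = q ^ 2 * P := by
    rw [hP, hq]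
    push_cast
    rw [← Finset.prod_pow, ← Finset.prod_mul_distrib]
    refine Finset.prod_congr rfl fun p hp => ?_
    have : (p : ℝ) ≠ 0 := by exact_mod_cast (hprime p hp).ne_zero
    field_simp
  have hmain : (q : ℝ) ^ 2 * P ≤ 3 * (m * q) * r3 n := by
    rw [← hPq]
    have : ∏ p ∈ s, (p ^ 2 + p) ≤ 3 * (m * q) * r3 n :=
      (hprod.trans (Nat.le_mul_of_pos_left _ hone)).trans hcount
    exact_mod_cast this
  have hlogP : Real.log Y / 2 ≤ D * P :=
    half_log_le_mul_prod_primesBelowNotDvd (2 * m) Y (by omega) (by omega)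
  have hm' : (1 : ℝ) ≤ m := by exact_mod_cast hm
  have hq' : (1 : ℝ) ≤ q := by exact_mod_cast hqpos
  have hlogY : 0 ≤ Real.log Y := Real.log_natCast_nonneg Y
  have hr : (q : ℝ) * Real.log Y ≤ 6 * m * D * r3 n := by
    have h1 : (q : ℝ) * P ≤ 3 * m * r3 n := by
      refine le_of_mul_le_mul_left (a := (q : ℝ)) ?_ (by linarith)
      linarith
    have h2 := mul_le_mul_of_nonneg_left h1 hDpos.le
    have h3 := mul_le_mul_of_nonneg_left hlogP (by linarith : (0 : ℝ) ≤ q)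
    linarith
  refine ⟨n, (ZMod.intCast_eq_intCast_iff _ _ _).1 (by simpa using hna), ?_, ?_⟩
  · have hM1 : 1 ≤ m * q := Nat.mul_pos hm hqpos
    have hll : Real.log (Real.log (n : ℝ)) ≤ 2 * Real.log Y :=
      (log_log_le_of_le hnle (by nlinarith)).trans (log_log_le_two_mul_log hM1
        (Nat.mul_le_mul_left m (prod_primesBelowNotDvd_le _ _)) hY)
    have hsq : Real.sqrt n ≤ 2 * (m * q) := by
      refine Real.sqrt_le_iff.2 ⟨by positivity, ?_⟩
      have : (n : ℝ) ≤ 3 * (m * q) ^ 2 := by exact_mod_cast hnle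
      nlinarith [sq_nonneg ((m : ℝ) * q)]
    have h4 : Real.sqrt n * Real.log (Real.log (n : ℝ)) ≤ 2 * (m * q) * (2 * Real.log Y) :=
      (mul_le_mul_of_nonneg_left hll (Real.sqrt_nonneg _)).trans
        (mul_le_mul_of_nonneg_right hsq (by linarith))
    rw [one_div, inv_mul_le_iff₀ (by positivity)]
    have h5 := mul_le_mul_of_nonneg_left hr (by linarith : (0 : ℝ) ≤ 4 * m)
    nlinarith
  · rw [one_div, inv_mul_le_iff₀ (by positivity)]
    have h5 : Real.log Y ≤ q * Real.log Y := le_mul_of_one_le_left hlogY hq'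
    have h6 : 6 * m * D * r3 n ≤ 6 * (m : ℝ) ^ 2 * D * r3 n := by
      gcongr
      nlinarith
    linarith

theorem theorem1 (m : ℕ) (hm : 1 ≤ m) :
    ∃ c : ℝ, 0 < c ∧ ∀ a : ℤ, IsSumThreeSquaresMod m a →
      {n : ℕ | (n : ℤ) ≡ a [ZMOD (m : ℤ)] ∧
        c * (Real.sqrt (n : ℝ) * Real.log (Real.log (n : ℝ))) ≤ (r3 n : ℝ)}.Infinite := by
  have hm' : (0 : ℝ) < m := by exact_mod_cast hm
  refine ⟨1 / (24 * m ^ 2 * 2 ^ (2 * m).primeFactors.card), by positivity, fun a ha hfin => ?_⟩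
  -- Finitely many `n` would bound `r3`, against its growth with `log Y`.
  obtain ⟨B, hB⟩ := (hfin.image r3).bddAbove
  have hlim : Filter.Tendsto (fun Y : ℕ =>
      1 / (6 * (m : ℝ) ^ 2 * 2 ^ (2 * m).primeFactors.card) * Real.log Y) Filter.atTop Filter.atTop :=
    (Real.tendsto_log_atTop.comp tendsto_natCast_atTop_atTop).const_mul_atTop (by positivity)
  obtain ⟨Y, hYB, hY⟩ := ((hlim.eventually_gt_atTop (B : ℝ)).and
    (Filter.eventually_ge_atTop (3 * m ^ 2 + 4))).exists
  obtain ⟨n, hn, h1, h2⟩ := exists_r3_ge m hm a ha Y hY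
  have hle : r3 n ≤ B := hB ⟨n, ⟨hn, h1⟩, rfl⟩
  have : (r3 n : ℝ) ≤ B := by exact_mod_cast hle
  linarith
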